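/- Let $\mathcal N_2$ denote the class of all groups $G$ with $[G,G]\subseteq Z(G)$. Let $A$ and $B$ be groups in $\mathcal N_2$ with a common subgroup $D$, that is, a group $D$ with fixed embeddings $D\hookrightarrow A$ and $D\hookrightarrow B$, by which $D$ is regarded as a subgroup of $A$ and of $B$. Assume that $D$ is co-central in $B$: there is a central subgroup $Z$ of $B$ with $\langle D,Z\rangle=B$ (equivalently, $\langle D,Z(B)\rangle=B$). Write $A_2=[A,A]$ and $[x,y]=x^{-1}y^{-1}xy$. A weak amalgam of $A$ and $B$ over $D$ in $\mathcal N_2$ is a group $G\in\mathcal N_2$ together with injective homomorphisms $A\to G$ and $B\to G$ that agree on $D$. Then a weak amalgam of $A$ and $B$ over $D$ in $\mathcal N_2$ exists if and only if the following condition holds: (**) for every integer $q>0$, every $a\in A$ with $a^q\in A_2D$, and every $z\in Z(B)$ with $z^q\in D$, one has $[a,z^q]=e$, where $z^q$ is regarded as an element of $D\subseteq A$ and the commutator is computed in $A$. -/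

import Mathlib

universe u v w

/-- Membership in the variety `𝒩₂`: groups `G` such that `[G, G] ⊆ Z(G)`. -/
def IsN2 (G : Type*) [Group G] : Prop :=
  commutator G ≤ Subgroup.center G

/-- A subgroup `X` of `B` is co-central if there is a central subgroup `Z` of `B` such that
`⟨X, Z⟩ = B`. -/
def IsCocentral {B : Type*} [Group B] (X : Subgroup B) : Prop :=
  ∃ Z : Subgroup B, Z ≤ Subgroup.center B ∧ X ⊔ Z = ⊤

theorem isCocentral_iff {B : Type*} [Group B] (X : Subgroup B) :
    IsCocentral X ↔ X ⊔ Subgroup.center B = ⊤ := by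
  constructor
  · rintro ⟨Z, hZ, h⟩
    exact top_le_iff.mp (h ▸ sup_le_sup_left hZ X)
  · intro h
    exact ⟨_, le_rfl, h⟩

/-- The amalgam of `A` and `B` over the common subgroup `D` (embedded in `A` by `i` and in `B`
by `j`) is weakly embeddable in `𝒩₂`: there is an `𝒩₂`-group `G` containing copies of `A` and `B`
in which the two copies of every element of `D` coincide. Since `G` may be replaced by the subgroup
generated by these copies, `Type (max u v)` is no restriction. -/
def HasWeakAmalgamN2 {A : Type u} {B : Type v} {D : Type w} [Group A] [Group B] [Group D]
    (i : D →* A) (j : D →* B) : Prop :=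
  ∃ (G : Type (max u v)) (_ : Group G), IsN2 G ∧
    ∃ (f : A →* G) (g : B →* G), Function.Injective f ∧ Function.Injective g ∧
      ∀ d : D, f (i d) = g (j d)

/-- For every `q > 0`, every `a ∈ A` with `a ^ q ∈ A₂ D` and every `z ∈ Z(B)` with `z ^ q ∈ D`,
the commutator `[a, z ^ q]` is trivial. Here `d` is the element `z ^ q` of `D`, and the
commutator is formed in `A`, with `[x, y] = x⁻¹ y⁻¹ x y`. As `A₂` is normal, the join
`A₂ ⊔ D` is the product set `A₂ D`. -/
def ConditionStarStar {A : Type u} {B : Type v} {D : Type w} [Group A] [Group B] [Group D]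
    (i : D →* A) (j : D →* B) : Prop :=
  ∀ q : ℕ, 0 < q → ∀ a : A, a ^ q ∈ commutator A ⊔ i.range →
    ∀ z ∈ Subgroup.center B, ∀ d : D, j d = z ^ q →
      a⁻¹ * (i d)⁻¹ * a * i d = 1

/-! Necessity is bilinearity of commutators in `G`: for `z ∈ Z(B)` the map `[z, ·]` kills `A₂` and
`D`, so `[z^q, a] = [z, a^q] = 1` whenever `a^q ∈ A₂D`.

For sufficiency put `E = D ∩ Z(B)` and `V = A/A₂D`. As `E` commutes with `D`, commutation in `A`
gives a pairing `V × E → Z(A)`. In an amalgam it must extend to `V × Z(B)`. After enlarging the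
target this is possible once the pairing kills the kernel of `V ⊗ E → V ⊗ Z(B)`. That kernel is the
image of `Tor(V, Z(B)/E)`, generated by the `v ⊗ e` with `qv = 0` and `e = qz`, which (**) kills
(`LinearMap.map_eq_zero_of_lTensor_eq_zero`). The extended pairing then serves as the commutator
between `A` and `Z(B)` in a twisted product, whose quotient by the forced identifications is the
amalgam (`hasWeakAmalgamN2_of_pairing`). -/

/-! ### Tensor kernels and extension of bilinear maps. -/

/-- A finitely generated abelian group has a finite generating family whose only relations are
those of the individual generators. -/
theorem AddCommGroup.exists_independent_generators (M : Type*) [AddCommGroup M]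
    [Module.Finite ℤ M] :
    ∃ (κ : Type) (_ : Fintype κ) (m : κ → M), Submodule.span ℤ (Set.range m) = ⊤ ∧
      ∀ a : κ → ℤ, ∑ k, a k • m k = 0 → ∀ k, a k • m k = 0 := by
  classical
  have : AddGroup.FG M := Module.Finite.iff_addGroup_fg.mp inferInstance
  obtain ⟨n, ι, _, p, -, e, ⟨f⟩⟩ := AddCommGroup.equiv_free_prod_directSum_zmod M
  let b : Fin n ⊕ ι → (Fin n →₀ ℤ) × DirectSum ι (fun i => ZMod (p i ^ e i)) :=
    Sum.elim (fun k => (Finsupp.single k 1, 0))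
      (fun i => (0, DirectSum.of (fun i => ZMod (p i ^ e i)) i 1))
  have hb : ∀ a : Fin n ⊕ ι → ℤ, ∑ k, a k • b k = (∑ k, Finsupp.single k (a (.inl k)),
      ∑ i, DirectSum.of (fun i => ZMod (p i ^ e i)) i (a (.inr i))) := by
    intro a
    rw [Fintype.sum_sum_type]
    have h1 : ∀ k, a (.inl k) • b (.inl k) = (Finsupp.single k (a (.inl k)), 0) := by
      intro k; simp [b]
    have h2 : ∀ i, a (.inr i) • b (.inr i) =
        (0, DirectSum.of (fun i => ZMod (p i ^ e i)) i (a (.inr i))) := by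
      intro i
      simp only [b, Sum.elim_inr, Prod.smul_mk, smul_zero]
      rw [← map_zsmul, zsmul_one]
    simp only [h1, h2]
    ext <;> simp [Prod.fst_sum, Prod.snd_sum]
  have hfb : ∀ a : Fin n ⊕ ι → ℤ, ∑ k, a k • f.symm (b k) = f.symm (∑ k, a k • b k) := by
    intro a; simp [map_sum, map_zsmul]
  refine ⟨Fin n ⊕ ι, inferInstance, fun k => f.symm (b k), ?_, ?_⟩
  · rw [eq_top_iff]
    intro x _
    rw [Submodule.mem_span_range_iff_exists_fun]
    refine ⟨Sum.elim (fun k => (f x).1 k) (fun i => ((f x).2 i).cast), ?_⟩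
    rw [hfb, hb, AddEquiv.symm_apply_eq]
    refine Prod.ext ?_ ?_
    · simp [Finsupp.univ_sum_single]
    · simpa using DirectSum.sum_univ_of (f x).2
  · intro a ha
    rw [hfb, AddEquivClass.map_eq_zero_iff, hb, Prod.mk_eq_zero] at ha
    have key : ∀ k, a k • b k = 0 := by
      rintro (k | i)
      · have := DFunLike.congr_fun ha.1 k
        simp only [Finsupp.coe_finsetSum, Finset.sum_apply, Finsupp.single_apply] at this
        simp at this
        simp [this]
      · have h3 := DFunLike.congr_fun ha.2 i
        have : ((a (.inr i) : ℤ) : ZMod (p i ^ e i)) = 0 := by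
          rw [DFinsupp.finsetSum_apply] at h3
          rw [Finset.sum_eq_single i] at h3
          · simpa using h3.trans (DirectSum.zero_apply _)
          · intro j _ hj
            exact DirectSum.of_eq_of_ne _ _ _ hj.symm
          · simp
        simp only [b, Sum.elim_inr, Prod.smul_mk, smul_zero]
        rw [← map_zsmul, zsmul_one, this, map_zero]
        rfl
    intro k
    rw [← map_zsmul, key, map_zero]

open TensorProduct in
/-- The elements `v ⊗ e` with `q v = 0` and `e = q z` for some `q > 0` generate the kernel of
`V ⊗ E → V ⊗ Z`, for `V` finitely generated. -/
theorem LinearMap.map_eq_zero_of_lTensor_eq_zero_of_finite {V Z E C : Type*} [AddCommGroup V]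
    [AddCommGroup Z] [AddCommGroup E] [AddCommGroup C] [Module.Finite ℤ V]
    (ι : E →ₗ[ℤ] Z) (hι : Function.Injective ι) (f : V ⊗[ℤ] E →ₗ[ℤ] C)
    (hf : ∀ q : ℕ, 0 < q → ∀ v : V, q • v = 0 → ∀ z : Z, ∀ e : E, ι e = q • z → f (v ⊗ₜ e) = 0)
    (x : V ⊗[ℤ] E) (hx : ι.lTensor V x = 0) : f x = 0 := by
  obtain ⟨κ, _, m, hm, hind⟩ := AddCommGroup.exists_independent_generators V
  have hxm : ∃ e : κ → E, x = ∑ k, m k ⊗ₜ e k := by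
    clear hx
    induction x with
    | zero => exact ⟨0, by simp⟩
    | tmul v e =>
      obtain ⟨c, rfl⟩ := (Submodule.mem_span_range_iff_exists_fun ℤ).mp
        (hm ▸ Submodule.mem_top : v ∈ Submodule.span ℤ (Set.range m))
      exact ⟨fun k => c k • e, by simp only [sum_tmul, smul_tmul]⟩
    | add x y hx hy =>
      obtain ⟨e, rfl⟩ := hx
      obtain ⟨e', rfl⟩ := hy
      exact ⟨e + e', by simp [tmul_add, Finset.sum_add_distrib]⟩
  obtain ⟨e, rfl⟩ := hxm
  have h0 : ∑ k, m k ⊗ₜ[ℤ] ι (e k) = 0 := by simpa using hx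
  -- Equational criterion: `ι (e k) = ∑ a k s • y s` with `∑ a k s • m k = 0` over `k` for each `s`.
  -- Independence of the `m k` makes every term vanish, so the order of `m k` divides `a k s`.
  obtain ⟨l, a, y, hy, ha⟩ := vanishesTrivially_of_sum_tmul_eq_zero ℤ hm h0
  rw [map_sum]
  refine Finset.sum_eq_zero fun k _ => ?_
  have hdvd : ∀ s, (addOrderOf (m k) : ℤ) ∣ a k s := fun s =>
    (addOrderOf_dvd_iff_zsmul_eq_zero).mpr (hind (fun k => a k s) (ha s) k)
  choose c hc using hdvd
  have hek : ι (e k) = addOrderOf (m k) • ∑ s, c s • y s := by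
    refine (hy k).trans ?_
    rw [Finset.smul_sum]
    refine Finset.sum_congr rfl fun s _ => ?_
    rw [hc, mul_smul, natCast_zsmul]
  -- Order `0` means infinite order; then `e k = 0` and no torsion hypothesis is needed.
  rcases Nat.eq_zero_or_pos (addOrderOf (m k)) with h | h
  · rw [h, zero_smul] at hek
    rw [hι (hek.trans (map_zero ι).symm), tmul_zero, map_zero]
  · exact hf _ h (m k) (addOrderOf_nsmul_eq_zero _) _ _ hek

open TensorProduct in
/-- The elements `v ⊗ e` with `q v = 0` and `e = q z` for some `q > 0` generate the kernel of
`V ⊗ E → V ⊗ Z`. -/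
theorem LinearMap.map_eq_zero_of_lTensor_eq_zero {V Z E C : Type*} [AddCommGroup V]
    [AddCommGroup Z] [AddCommGroup E] [AddCommGroup C]
    (ι : E →ₗ[ℤ] Z) (hι : Function.Injective ι) (f : V ⊗[ℤ] E →ₗ[ℤ] C)
    (hf : ∀ q : ℕ, 0 < q → ∀ v : V, q • v = 0 → ∀ z : Z, ∀ e : E, ι e = q • z → f (v ⊗ₜ e) = 0)
    (x : V ⊗[ℤ] E) (hx : ι.lTensor V x = 0) : f x = 0 := by
  -- Both `x` and the vanishing of its image involve finitely many elements of `V`: `x` comes from a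
  -- finitely generated `P`, and its image already vanishes over a larger finitely generated `Q`.
  obtain ⟨P, hP, hxP⟩ := TensorProduct.exists_finite_submodule_left_of_setFinite {x}
    (Set.finite_singleton x)
  obtain ⟨t, rfl⟩ := hxP rfl
  have ht : P.subtype.rTensor Z (ι.lTensor P t) = 0 := by
    rw [← hx, ← LinearMap.comp_apply, ← LinearMap.comp_apply, LinearMap.rTensor_comp_lTensor,
      LinearMap.lTensor_comp_rTensor]
  obtain ⟨Q, hPQ, hQ, htQ⟩ := TensorProduct.eq_zero_of_fg_of_subtype_eq_zero
    (Module.Finite.iff_fg.mp hP) ht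
  have : Module.Finite ℤ Q := Module.Finite.iff_fg.mpr hQ
  have key := map_eq_zero_of_lTensor_eq_zero_of_finite ι hι (f ∘ₗ Q.subtype.rTensor E)
    (fun q hq v hv z e he => hf q hq v (by simpa using congrArg Subtype.val hv) z e he)
    ((Submodule.inclusion hPQ).rTensor E t) (by
      rw [← htQ, ← LinearMap.comp_apply, ← LinearMap.comp_apply, LinearMap.rTensor_comp_lTensor,
        LinearMap.lTensor_comp_rTensor])
  rw [← Submodule.subtype_comp_inclusion _ _ hPQ, LinearMap.rTensor_comp_apply]
  exact key

open TensorProduct in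
/-- A bilinear map `β : V × E → C` that kills all `(v, e)` with `q v = 0` and `e = q z`, `q > 0`,
extends to `V × Z` after enlarging `C`. -/
theorem LinearMap.exists_bilinear_extension {V : Type u} {Z : Type v} {E : Type w} {C : Type u}
    [AddCommGroup V] [AddCommGroup Z] [AddCommGroup E] [AddCommGroup C]
    (ι : E →ₗ[ℤ] Z) (hι : Function.Injective ι) (β : V →ₗ[ℤ] E →ₗ[ℤ] C)
    (hβ : ∀ q : ℕ, 0 < q → ∀ v : V, q • v = 0 → ∀ z : Z, ∀ e : E, ι e = q • z → β v e = 0) :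
    ∃ (T : Type (max u v)) (_ : AddCommGroup T) (c : C →ₗ[ℤ] T) (γ : V →ₗ[ℤ] Z →ₗ[ℤ] T),
      Function.Injective c ∧ ∀ v e, γ v (ι e) = c (β v e) := by
  -- The quotient by `M` is the pushout of `C` and `V ⊗ Z` over `V ⊗ E`.
  let M : Submodule ℤ (C × V ⊗[ℤ] Z) :=
    LinearMap.range ((TensorProduct.lift β).prod (-ι.lTensor V))
  refine ⟨(C × V ⊗[ℤ] Z) ⧸ M, inferInstance, M.mkQ ∘ₗ LinearMap.inl ℤ _ _,
    (TensorProduct.mk ℤ V Z).compr₂ (M.mkQ ∘ₗ LinearMap.inr ℤ _ _), ?_, ?_⟩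
  · rw [injective_iff_map_eq_zero]
    intro a ha
    rw [LinearMap.comp_apply, Submodule.mkQ_apply, Submodule.Quotient.mk_eq_zero] at ha
    obtain ⟨x, hx⟩ := ha
    have h1 : TensorProduct.lift β x = a := congrArg Prod.fst hx
    have h2 : -ι.lTensor V x = 0 := congrArg Prod.snd hx
    rw [← h1]
    exact map_eq_zero_of_lTensor_eq_zero ι hι _
      (fun q hq v hv z e he => (TensorProduct.lift.tmul v e).trans (hβ q hq v hv z e he)) x (neg_eq_zero.mp h2)
  · intro v e
    simp only [LinearMap.compr₂_apply, LinearMap.comp_apply, Submodule.mkQ_apply]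
    refine ((Submodule.Quotient.eq M).mpr ⟨v ⊗ₜ e, ?_⟩).symm
    exact Prod.ext (by
      change TensorProduct.lift β (v ⊗ₜ e) = _
      rw [TensorProduct.lift.tmul]
      simp) (by
      change -(ι.lTensor V (v ⊗ₜ e)) = _
      simp)

/-! ### Groups of class two and the twisted product. -/

open scoped commutatorElement IsMulCommutative

theorem IsN2.commutatorElement_mem_center {G : Type*} [Group G] (hG : IsN2 G) (x y : G) :
    ⁅x, y⁆ ∈ Subgroup.center G :=
  hG (Subgroup.commutator_mem_commutator (Subgroup.mem_top x) (Subgroup.mem_top y))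

theorem isN2_of_commutatorElement_mem_center {G : Type*} [Group G]
    (h : ∀ x y : G, ⁅x, y⁆ ∈ Subgroup.center G) : IsN2 G :=
  Subgroup.commutator_le.mpr fun x _ y _ => h x y

theorem IsN2.of_surjective {G H : Type*} [Group G] [Group H] (hG : IsN2 G) (f : G →* H)
    (hf : Function.Surjective f) : IsN2 H := by
  refine isN2_of_commutatorElement_mem_center fun x y => ?_
  obtain ⟨x, rfl⟩ := hf x
  obtain ⟨y, rfl⟩ := hf y
  rw [Subgroup.mem_center_iff]
  intro z
  obtain ⟨z, rfl⟩ := hf z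
  rw [← map_commutatorElement, ← map_mul, ← map_mul,
    Subgroup.mem_center_iff.mp (hG.commutatorElement_mem_center x y)]

/-- A homomorphism to a commutative group kills the commutator subgroup. -/
theorem MonoidHom.map_eq_one_of_mem_commutator {A M : Type*} [Group A] [CommGroup M]
    (γ : A →* M) {a : A} (ha : a ∈ commutator A) : γ a = 1 :=
  Abelianization.commutator_subset_ker γ ha

/-- The group of products `a z t`, with `t` central and `z a = a z (γ a z)`. -/
@[ext]
structure TwistedProduct {A Z T : Type*} [Group A] [CommGroup Z] [CommGroup T]
    (γ : A →* Z →* T) where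
  a : A
  z : Z
  t : T

namespace TwistedProduct

variable {A Z T : Type*} [Group A] [CommGroup Z] [CommGroup T] {γ : A →* Z →* T}

instance : Mul (TwistedProduct γ) :=
  ⟨fun x y => ⟨x.a * y.a, x.z * y.z, x.t * y.t * γ y.a x.z⟩⟩

instance : One (TwistedProduct γ) := ⟨⟨1, 1, 1⟩⟩

instance : Inv (TwistedProduct γ) := ⟨fun x => ⟨x.a⁻¹, x.z⁻¹, x.t⁻¹ * γ x.a x.z⟩⟩

@[simp] theorem mul_a (x y : TwistedProduct γ) : (x * y).a = x.a * y.a := rfl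
@[simp] theorem mul_z (x y : TwistedProduct γ) : (x * y).z = x.z * y.z := rfl
@[simp] theorem mul_t (x y : TwistedProduct γ) : (x * y).t = x.t * y.t * γ y.a x.z := rfl
@[simp] theorem one_a : (1 : TwistedProduct γ).a = 1 := rfl
@[simp] theorem one_z : (1 : TwistedProduct γ).z = 1 := rfl
@[simp] theorem one_t : (1 : TwistedProduct γ).t = 1 := rfl
@[simp] theorem inv_a (x : TwistedProduct γ) : x⁻¹.a = x.a⁻¹ := rfl
@[simp] theorem inv_z (x : TwistedProduct γ) : x⁻¹.z = x.z⁻¹ := rfl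
@[simp] theorem inv_t (x : TwistedProduct γ) : x⁻¹.t = x.t⁻¹ * γ x.a x.z := rfl

instance : Group (TwistedProduct γ) :=
  Group.ofLeftAxioms
    (fun x y w => TwistedProduct.ext (mul_assoc _ _ _) (mul_assoc _ _ _) (by
      simp only [mul_t, mul_a, mul_z, map_mul, MonoidHom.mul_apply]
      simp only [mul_assoc, mul_left_comm, mul_comm]))
    (fun x => TwistedProduct.ext (one_mul _) (one_mul _) (by simp))
    (fun x => TwistedProduct.ext (inv_mul_cancel _) (inv_mul_cancel _) (by simp))

/-- A commutator has trivial `Z`-coordinate, and its `A`-coordinate is killed by `γ`, whose target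
is commutative. So no twist appears and centrality is inherited from `A`. -/
theorem isN2 (hA : IsN2 A) : IsN2 (TwistedProduct γ) := by
  refine isN2_of_commutatorElement_mem_center fun x y => ?_
  rw [Subgroup.mem_center_iff]
  intro w
  have ha : ⁅x, y⁆.a = ⁅x.a, y.a⁆ := rfl
  have hz : ⁅x, y⁆.z = 1 := by
    change x.z * y.z * x.z⁻¹ * y.z⁻¹ = 1
    rw [mul_comm x.z, mul_inv_cancel_right, mul_inv_cancel]
  have hγ : γ ⁅x, y⁆.a = 1 := by
    rw [ha, map_commutatorElement, commutatorElement_eq_one_iff_mul_comm, mul_comm]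
  refine TwistedProduct.ext ?_ (mul_comm _ _) ?_
  · simpa only [mul_a, ha] using
      Subgroup.mem_center_iff.mp (hA.commutatorElement_mem_center x.a y.a) w.a
  · simp only [mul_t, hγ, hz, map_one, MonoidHom.one_apply, mul_one, mul_comm]

end TwistedProduct

/-! ### The amalgam as a quotient of the twisted product. -/

section Amalgam

variable {A : Type u} {B : Type v} {D : Type w} [Group A] [Group B] [Group D]
  {Z : Type v} [CommGroup Z] (ψ : Z →* B) (i : D →* A) (j : D →* B) {T : Type*} [CommGroup T]
  (c : Subgroup.center A →* T) (γ : A →* Z →* T)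

/-- The relations identifying the elements of `D` that are central in `B` with their images in
`A`, and the values of `γ` with commutators in `A`. -/
def TwistedProduct.relations (hψ : ∀ z, ψ z ∈ Subgroup.center B) (hγ : ∀ d, γ (i d) = 1) : Subgroup (TwistedProduct γ) where
  -- Taking `ζ` in the commutator subgroup gives `γ ζ = 1`, so the set is closed under products.
  carrier := {x | ∃ d : D, ∃ ζ : Subgroup.center A, (ζ : A) ∈ commutator A ∧
    x.a = i d * ζ ∧ ψ x.z * j d = 1 ∧ x.t * c ζ = 1}
  one_mem' := ⟨1, 1, one_mem _, by simp⟩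
  mul_mem' := by
    rintro x y ⟨d, ζ, hζ, h1, h2, h3⟩ ⟨d', ζ', hζ', h1', h2', h3'⟩
    refine ⟨d * d', ζ * ζ', mul_mem hζ hζ', ?_, ?_, ?_⟩
    · rw [mul_a, h1, h1', map_mul, Subgroup.coe_mul, mul_assoc, mul_assoc, ← mul_assoc (ζ : A),
        ← Subgroup.mem_center_iff.mp ζ.2 (i d')]
      simp only [mul_assoc]
    · rw [mul_z, mul_comm x.z, map_mul ψ, map_mul j, mul_assoc, ← mul_assoc (ψ x.z), h2,
        one_mul, h2']
    · rw [mul_t, h1', map_mul γ, hγ, γ.map_eq_one_of_mem_commutator hζ', mul_one,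
        MonoidHom.one_apply, mul_one, map_mul, mul_mul_mul_comm, h3, h3', mul_one]
  inv_mem' := by
    rintro x ⟨d, ζ, hζ, h1, h2, h3⟩
    refine ⟨d⁻¹, ζ⁻¹, inv_mem hζ, ?_, ?_, ?_⟩
    · rw [inv_a, h1, mul_inv_rev, map_inv, Subgroup.coe_inv,
        Subgroup.mem_center_iff.mp (inv_mem ζ.2)]
    · rw [inv_z, map_inv, map_inv, ← mul_inv_rev, inv_eq_one,
        Subgroup.mem_center_iff.mp (hψ _), h2]
    · rw [inv_t, h1, map_mul γ, hγ, γ.map_eq_one_of_mem_commutator hζ, mul_one,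
        MonoidHom.one_apply, mul_one, map_inv, ← mul_inv, h3, inv_one]

/-- Conjugation by `x` changes the `A`-coordinate by a commutator of `i d` with `x.a` and the
`T`-coordinate by a value of `γ`. By `hcγ` the two changes match under `c`, so only `ζ` is shifted.
-/
theorem TwistedProduct.relations_normal (hA : IsN2 A) (hψ : ∀ z, ψ z ∈ Subgroup.center B) (hγ : ∀ d, γ (i d) = 1)
    (hcγ : ∀ (a : A) (z : Z) (d : D), ψ z = j d →
      γ a z = c ⟨⁅i d, a⁆, hA.commutatorElement_mem_center _ _⟩) :
    (relations ψ i j c γ hψ hγ).Normal where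
  conj_mem := by
    rintro n ⟨d, ζ, hζ, h1, h2, h3⟩ x
    have hη := hA.commutatorElement_mem_center (i d) x.a
    have hγn : γ n.a = 1 := by
      rw [h1, map_mul, hγ, γ.map_eq_one_of_mem_commutator hζ, mul_one]
    have hγx : (γ x.a n.z)⁻¹ = c ⟨⁅i d, x.a⁆, hη⟩ := by
      rw [← map_inv, hcγ x.a n.z⁻¹ d (by rw [map_inv, inv_eq_of_mul_eq_one_right h2])]
    refine ⟨d, ζ * ⟨⁅i d, x.a⁆, hη⟩⁻¹, mul_mem hζ (inv_mem (Subgroup.commutator_mem_commutator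
      (Subgroup.mem_top _) (Subgroup.mem_top _))), ?_, ?_, ?_⟩
    · have h4 : (⁅i d, x.a⁆)⁻¹ * i d = x.a * i d * x.a⁻¹ := by
        simp only [commutatorElement_def]; group
      have h5 := Subgroup.mem_center_iff.mp ζ.2
      have h6 := Subgroup.mem_center_iff.mp (inv_mem hη)
      calc x.a * n.a * x.a⁻¹ = x.a * i d * x.a⁻¹ * ζ := by
            simp only [h1, mul_assoc, h5 x.a⁻¹]
        _ = _ := by
            rw [← h4, ← h6, mul_assoc, h5]; rfl
    · rwa [mul_z, mul_z, inv_z, mul_comm x.z, mul_inv_cancel_right]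
    · rw [mul_t, mul_t, inv_t, inv_a, mul_z, hγn, map_inv, MonoidHom.one_apply, mul_one,
        MonoidHom.inv_apply, map_mul, mul_inv, hγx, map_mul, map_inv]
      calc _ = n.t * c ζ := by
            simp only [mul_assoc, mul_left_comm, mul_comm, mul_inv_cancel_left]
            rw [mul_inv_cancel, mul_one]
        _ = 1 := h3

/-- By co-centrality `B` is a quotient of `D × Z`, which maps to the twisted product because `γ`
kills `D`. Injectivity of `c` forces `ζ = 1` in a relation with trivial `T`-coordinate, so neither
`A` nor `B` collapses. -/
theorem hasWeakAmalgamN2_of_pairing {T : Type (max u v)} [CommGroup T]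
    (c : Subgroup.center A →* T) (γ : A →* Z →* T) (hA : IsN2 A)
    (hi : Function.Injective i) (hj : Function.Injective j) (hψ : ∀ z, ψ z ∈ Subgroup.center B)
    (hD : j.range ⊔ ψ.range = ⊤) (hc : Function.Injective c)
    (hγ : ∀ d, γ (i d) = 1)
    (hcγ : ∀ (a : A) (z : Z) (d : D), ψ z = j d →
      γ a z = c ⟨⁅i d, a⁆, hA.commutatorElement_mem_center _ _⟩) :
    HasWeakAmalgamN2 i j := by
  let N := TwistedProduct.relations ψ i j c γ hψ hγ
  have : N.Normal := TwistedProduct.relations_normal ψ i j c γ hA hψ hγ hcγ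
  let f₀ : A →* TwistedProduct γ :=
    { toFun := fun a => ⟨a, 1, 1⟩
      map_one' := rfl
      map_mul' := fun a b => TwistedProduct.ext rfl (by simp) (by simp) }
  let g₀ : D × Z →* TwistedProduct γ :=
    { toFun := fun x => ⟨i x.1, x.2, 1⟩
      map_one' := TwistedProduct.ext (map_one i) rfl rfl
      map_mul' := fun a b => TwistedProduct.ext (map_mul i _ _) rfl (by simp [hγ]) }
  let p : D × Z →* B := j.noncommCoprod ψ fun d z => Subgroup.mem_center_iff.mp (hψ z) (j d)
  have hs : Function.Surjective p := by
    rw [← MonoidHom.range_eq_top, ← hD]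
    exact MonoidHom.noncommCoprod_range _ _ _
  -- One direction makes `g` well defined on `B`, the other makes it injective.
  have hker : ∀ x, g₀ x ∈ N ↔ p x = 1 := by
    rintro ⟨d, z⟩
    have hx : p (d, z) = ψ z * j d := Subgroup.mem_center_iff.mp (hψ z) (j d)
    rw [hx]
    constructor
    · rintro ⟨d', ζ, -, h1, h2, h3⟩
      have hζ : ζ = 1 := hc (by simpa [g₀] using h3)
      have hd : i d = i d' := by simpa [g₀, hζ] using h1
      rw [hi hd]
      exact h2
    · intro h
      exact ⟨d, 1, one_mem _, by simp [g₀], h, by simp [g₀]⟩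
  let g : B →* TwistedProduct γ ⧸ N := p.liftOfSurjective hs
    ⟨(QuotientGroup.mk' N).comp g₀, fun x hx =>
      (QuotientGroup.eq_one_iff _).mpr ((hker x).mpr hx)⟩
  have hg : ∀ x, g (p x) = QuotientGroup.mk' N (g₀ x) := fun x =>
    MonoidHom.liftOfRightInverse_comp_apply _ _ _ _ x
  refine ⟨TwistedProduct γ ⧸ N, inferInstance,
    (TwistedProduct.isN2 hA).of_surjective _ (QuotientGroup.mk'_surjective N),
    (QuotientGroup.mk' N).comp f₀, g, ?_, ?_, ?_⟩
  · rw [injective_iff_map_eq_one]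
    intro a ha
    obtain ⟨d, ζ, -, h1, h2, h3⟩ := (QuotientGroup.eq_one_iff _).mp ha
    have hd : d = 1 := hj (by simpa [f₀] using h2)
    have hζ : ζ = 1 := hc (by simpa [f₀] using h3)
    simpa [f₀, hd, hζ] using h1
  · rw [injective_iff_map_eq_one]
    intro b hb
    obtain ⟨x, rfl⟩ := hs b
    rw [hg] at hb
    exact (hker x).mp ((QuotientGroup.eq_one_iff _).mp hb)
  · intro d
    have : j d = p (d, 1) := by
      change j d = j d * ψ 1
      rw [map_one, mul_one]
    rw [this, hg]
    rfl

end Amalgam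

/-! ### The commutator pairing and the two implications. -/

/-- A bilinear map `β : V × E → C` that kills all `(v, e)` with `v ^ q = 1` and `e = z ^ q`,
`q > 0`, extends to `V × Z` after enlarging `C`. -/
theorem MonoidHom.exists_bilinear_extension {V : Type u} {Z : Type v} {E : Type w} {C : Type u}
    [CommGroup V] [CommGroup Z] [CommGroup E] [CommGroup C]
    (ι : E →* Z) (hι : Function.Injective ι) (β : V →* E →* C)
    (hβ : ∀ q : ℕ, 0 < q → ∀ v : V, v ^ q = 1 → ∀ z : Z, ∀ e : E, ι e = z ^ q → β v e = 1) :
    ∃ (T : Type (max u v)) (_ : CommGroup T) (c : C →* T) (γ : V →* Z →* T),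
      Function.Injective c ∧ ∀ v e, γ v (ι e) = c (β v e) := by
  let β' : Additive V →ₗ[ℤ] Additive E →ₗ[ℤ] Additive C :=
    LinearMap.mk₂ ℤ (fun v e => Additive.ofMul (β v.toMul e.toMul))
      (fun v w e => by simp) (fun n v e => by simp) (fun v e e' => by simp) (fun n v e => by simp)
  obtain ⟨T, _, c, γ, hc, hγ⟩ := LinearMap.exists_bilinear_extension
    ι.toAdditive.toIntLinearMap hι β' hβ
  refine ⟨Multiplicative T, inferInstance, AddMonoidHom.toMultiplicativeRight c.toAddMonoidHom,
    MonoidHom.mk' (fun v => MonoidHom.mk'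
      (fun z => Multiplicative.ofAdd (γ (Additive.ofMul v) (Additive.ofMul z))) ?_) ?_, hc, ?_⟩
  · intro z z'
    simp
  · intro v w
    ext z
    simp
  · exact hγ

/-- The commutator pairing of a group in `𝒩₂`. -/
def IsN2.commutatorHom {G : Type*} [Group G] (hG : IsN2 G) : G →* G →* Subgroup.center G :=
  MonoidHom.mk' (fun x => MonoidHom.mk'
    (fun a => ⟨⁅x, a⁆, hG.commutatorElement_mem_center x a⟩) (by
      intro a b
      have h := Subgroup.mem_center_iff.mp (hG.commutatorElement_mem_center x b) a
      refine Subtype.ext ?_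
      calc ⁅x, a * b⁆ = ⁅x, a⁆ * (a * ⁅x, b⁆) * a⁻¹ := by simp only [commutatorElement_def]; group
        _ = ⁅x, a⁆ * ⁅x, b⁆ := by rw [h]; group)) (by
    intro x y
    ext a
    have h := Subgroup.mem_center_iff.mp (hG.commutatorElement_mem_center y a) x
    calc ⁅x * y, a⁆ = (x * ⁅y, a⁆) * x⁻¹ * ⁅x, a⁆ := by simp only [commutatorElement_def]; group
      _ = ⁅y, a⁆ * ⁅x, a⁆ := by rw [h]; group
      _ = ⁅x, a⁆ * ⁅y, a⁆ :=
        (Subgroup.mem_center_iff.mp (hG.commutatorElement_mem_center y a) _).symm)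

theorem conditionStarStar_of_hasWeakAmalgamN2 {A : Type u} {B : Type v} {D : Type w} [Group A]
    [Group B] [Group D] (i : D →* A) (j : D →* B) (h : HasWeakAmalgamN2 i j) :
    ConditionStarStar i j := by
  obtain ⟨G, _, hG, f, g, hf, -, hfg⟩ := h
  intro q _ a ha z hz d hd
  let K := (hG.commutatorHom (g z)).comp f
  have hle : commutator A ⊔ i.range ≤ K.ker := by
    refine sup_le (Abelianization.commutator_subset_ker K) ?_
    rintro _ ⟨e, rfl⟩
    refine Subtype.ext ?_
    change ⁅g z, f (i e)⁆ = 1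
    rw [hfg, ← map_commutatorElement, commutatorElement_eq_one_iff_mul_comm.mpr
      (Subgroup.mem_center_iff.mp hz _).symm, map_one]
  have h1 : hG.commutatorHom (f (i d)) (f a) = 1 := by
    rw [hfg, hd, map_pow, map_pow, MonoidHom.pow_apply, ← map_pow, ← map_pow]
    exact hle ha
  have h2 : ⁅i d, a⁆ = 1 := hf (by
    rw [map_commutatorElement, map_one]
    exact congrArg Subtype.val h1)
  rw [commutatorElement_eq_one_iff_mul_comm] at h2
  rw [mul_assoc, ← h2, mul_assoc, inv_mul_cancel_left, inv_mul_cancel]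

theorem hasWeakAmalgamN2_of_conditionStarStar {A : Type u} {B : Type v} {D : Type w} [Group A]
    [Group B] [Group D] (hA : IsN2 A) (i : D →* A) (j : D →* B) (hi : Function.Injective i)
    (hj : Function.Injective j) (hD : IsCocentral j.range) (h : ConditionStarStar i j) :
    HasWeakAmalgamN2 i j := by
  -- `E` is `D ∩ Z(B)`, and `κ` reads its elements back in `D`.
  let E := j.range.subgroupOf (Subgroup.center B)
  let κ : E →* D := (MonoidHom.ofInjective hj).symm.toMonoidHom.comp
    ((Subgroup.center B).subtype.subgroupComap j.range)
  have hκ : ∀ e : E, j (κ e) = (e : Subgroup.center B) := fun e =>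
    congrArg Subtype.val ((MonoidHom.ofInjective hj).apply_symm_apply _)
  have hκc : ∀ e d, d * κ e = κ e * d := fun e d => hj (by
    rw [map_mul, map_mul, hκ, Subgroup.mem_center_iff.mp (e : Subgroup.center B).2])
  let β₀ : A →* E →* Subgroup.center A :=
    (MonoidHom.compHom' (i.comp κ)).comp hA.commutatorHom.flip
  have hβ₀ : ∀ a e, (β₀ a e : A) = ⁅i (κ e), a⁆ := fun _ _ => rfl
  let R := i.range.map (Abelianization.of (G := A))
  -- The source is `A/A₂D`; the pairing descends since elements of `E` are central in `B`, hence
  -- commute with `D`.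
  let β : Abelianization A ⧸ R →* E →* Subgroup.center A :=
    QuotientGroup.lift R (Abelianization.lift β₀) (by
      rintro _ ⟨_, ⟨d, rfl⟩, rfl⟩
      refine MonoidHom.ext fun e => Subtype.ext ?_
      change ⁅i (κ e), i d⁆ = 1
      rw [← map_commutatorElement, commutatorElement_eq_one_iff_mul_comm.mpr (hκc e d).symm,
        map_one])
  let π : A →* Abelianization A ⧸ R := (QuotientGroup.mk' R).comp Abelianization.of
  have hβ : ∀ a e, β (π a) e = β₀ a e := fun _ _ => rfl
  obtain ⟨T, _, c, γ, hc, hγ⟩ := MonoidHom.exists_bilinear_extension E.subtype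
    Subtype.val_injective β (by
      intro q hq v hv z e he
      obtain ⟨v, rfl⟩ := QuotientGroup.mk_surjective v
      obtain ⟨a, rfl⟩ := QuotientGroup.mk_surjective v
      change β (π a) e = 1
      -- Torsion in `A/A₂D` is exactly the hypothesis on `a` in (**).
      have ha : a ^ q ∈ commutator A ⊔ i.range := by
        obtain ⟨_, ⟨d, rfl⟩, hd⟩ := (QuotientGroup.eq_one_iff (N := R) _).mp hv
        have hc : (i d)⁻¹ * a ^ q ∈ commutator A := QuotientGroup.eq.mp hd
        rw [← mul_inv_cancel_left (i d) (a ^ q)]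
        exact mul_mem (Subgroup.mem_sup_right ⟨d, rfl⟩) (Subgroup.mem_sup_left hc)
      have h1 := h q hq a ha z z.2 (κ e) ((hκ e).trans (congrArg Subtype.val he))
      refine Subtype.ext ?_
      rw [hβ, hβ₀, OneMemClass.coe_one, commutatorElement_eq_one_iff_mul_comm]
      rw [mul_assoc, mul_assoc, inv_mul_eq_one, eq_inv_mul_iff_mul_eq] at h1
      exact h1)
  refine hasWeakAmalgamN2_of_pairing (Subgroup.center B).subtype i j c (γ.comp π) hA hi hj
    (fun z => z.2) ?_ hc ?_ ?_
  · rw [Subgroup.range_subtype]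
    exact (isCocentral_iff _).mp hD
  · intro d
    have : π (i d) = 1 := (QuotientGroup.eq_one_iff _).mpr ⟨i d, ⟨d, rfl⟩, rfl⟩
    rw [MonoidHom.comp_apply, this, map_one]
  · intro a z d hz
    have he := hγ (π a) ⟨z, ⟨d, hz.symm⟩⟩
    have hd : κ ⟨z, ⟨d, hz.symm⟩⟩ = d := hj ((hκ _).trans hz)
    refine he.trans (congrArg c (Subtype.ext ?_))
    rw [hβ, hβ₀, hd]

theorem mainTheorem1 {A : Type u} {B : Type v} {D : Type w} [Group A] [Group B] [Group D]
    (hA : IsN2 A) (hB : IsN2 B)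
    (i : D →* A) (j : D →* B) (hi : Function.Injective i) (hj : Function.Injective j)
    (hD : IsCocentral j.range) :
    HasWeakAmalgamN2 i j ↔ ConditionStarStar i j :=
  ⟨conditionStarStar_of_hasWeakAmalgamN2 i j,
    hasWeakAmalgamN2_of_conditionStarStar hA i j hi hj hD⟩
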